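/- Let $k$ be a field, $A$ an associative unital $k$-algebra, $B$ a commutative unital $k$-algebra, and $\varepsilon:B\to A$ a homomorphism of unital $k$-algebras whose image lies in the centre of $A$. For $n\ge 0$ let $$C^n=C^n((A,B,\varepsilon);A)=\mathrm{Hom}_k\bigl(A^{\otimes n}\otimes B^{\otimes n(n-1)/2},A\bigr),$$ and $C^n=0$ for $n<0$. A pure tensor $T$ in $A^{\otimes n}\otimes B^{\otimes n(n-1)/2}$ is written as an upper triangular matrix with diagonal entries $a_1,\dots,a_n\in A$ and entries $b_{i,j}\in B$ for $1\le i<j\le n$. For such $T$, let $T^i_{j}$ denote the submatrix on the rows and columns $i+1,\dots,j$. For a matrix $T$ of size $N=m+n-1$, an integer $0\le i\le m-1$ and $x\in A$, let $T[i,n;x]$ be the matrix of size $m$ obtained by merging the $n$ consecutive indices $i+1,\dots,i+n$ into a single index in position $i+1$: its diagonal is $a_1,\dots,a_i,x,a_{i+n+1},\dots,a_N$, and each of its entries above the diagonal is the product of all entries $b_{u,v}$ of $T$ for which $u$ belongs to its row and $v$ to its column after merging (the empty product, which occurs for $n=0$, is $1$). For $m,n\ge 0$, $f\in C^m$ and $g\in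 C^n$ put $$(f\circ_i g)(T)=f\bigl(T[i,n;g(T^i_{i+n})]\bigr)\quad(0\le i\le m-1),\qquad f\circ g=\sum_{i=0}^{m-1}(-1)^{(n-1)i}f\circ_i g\in C^{m+n-1},$$ $$(f\smile g)(T)=f(T^0_m)\prod_{1\le i\le m<j\le m+n}\varepsilon(b_{i,j})\;g(T^m_{m+n}),\qquad f\smile g\in C^{m+n},$$ and define $\delta^\varepsilon:C^n\to C^{n+1}$ for $n\ge 0$ by the following formula (in negative degrees all operations are zero): $$\delta^\varepsilon(f)(T)=a_1\,\varepsilon\Bigl(\prod_{j=2}^{n+1}b_{1,j}\Bigr)f(T^1_{n+1})+\sum_{i=1}^{n}(-1)^i f\bigl(T[i-1,2;\varepsilon(b_{i,i+1})a_ia_{i+1}]\bigr)+(-1)^{n+1}f(T^0_n)\,a_{n+1}\,\varepsilon\Bigl(\prod_{i=1}^{n}b_{i,n+1}\Bigr).$$ **Theorem.** For all integers $m,n$ and all $f\in C^m$, $g\in C^n$, the following identity holds in $C^{m+n}$: $$f\circ\delta^{\varepsilon}g-\delta^{\varepsilon}(f\circ g)+(-1)^{n-1}\,\delta^{\varepsilon}f\circ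 g=(-1)^{n-1}\bigl(g\smile f-(-1)^{mn}f\smile g\bigr).$$ -/

import Mathlib

open scoped TensorProduct

namespace SecondaryHochschild

section Matrices

/-- The positions `(i, j)`, `i < j`, above the diagonal of an `n × n` matrix; there are
`n (n - 1) / 2` of them. Indices start at `0`. -/
abbrev Pair (n : ℕ) : Type := {p : Fin n × Fin n // p.1 < p.2}

variable {A B : Type*} {m n N : ℕ}

/-- The inclusion of the `n` consecutive indices `i, …, i + n - 1` into `Fin N`. -/
def window (i n : ℕ) (h : i + n ≤ N) (j : Fin n) : Fin N := ⟨i + j, by omega⟩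

/-- The induced inclusion of the positions above the diagonal. -/
def windowPair (i n : ℕ) (h : i + n ≤ N) (P : Pair n) : Pair N :=
  ⟨(window i n h P.1.1, window i n h P.1.2), by
    have := P.2; simp only [window, Fin.lt_def] at *; omega⟩

/-- For `N = m + n - 1`: the monotone map `Fin N → Fin m` that collapses the `n` consecutive
indices `i, …, i + n - 1` to the single index `i` (if `n = 0`, it skips the index `i`). -/
def collapse (h : N + 1 = m + n) (i : Fin m) (t : Fin N) : Fin m :=
  ⟨if (t : ℕ) < i then t else if (t : ℕ) < i + n then i else t + 1 - n, by
    have := i.2; have := t.2; split_ifs <;> omega⟩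

/-- The diagonal of the matrix in which the diagonal entries `i, …, i + n - 1` are
replaced by the single entry `x`: `(a_0, …, a_{i-1}, x, a_{i+n}, …, a_{N-1})`. -/
def mergeA (h : N + 1 = m + n) (i : Fin m) (x : A) (a : Fin N → A) (s : Fin m) : A :=
  if h₁ : s < i then a ⟨s, by have := i.2; simp only [Fin.lt_def] at h₁; omega⟩
  else if h₂ : s = i then x
  else a ⟨s - 1 + n, by
    have := s.2; have := i.2; simp only [Fin.lt_def, Fin.ext_iff] at h₁ h₂; omega⟩

/-- The entries above the diagonal after the rows (and the columns) `i, …, i + n - 1` are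
merged into one by multiplication: the entry at `(s, t)` is the product of all `b_{u,v}` with `u`
collapsed to `s` and `v` collapsed to `t`. -/
def mergeB [CommMonoid B] (h : N + 1 = m + n) (i : Fin m) (b : Pair N → B) (Q : Pair m) : B :=
  ∏ P : Pair N with collapse h i P.1.1 = Q.1.1 ∧ collapse h i P.1.2 = Q.1.2, b P

end Matrices

section Cochains

variable (k A B : Type*) [Field k] [Ring A] [Algebra k A] [CommRing B] [Algebra k B]

/-- `A^{⊗ n} ⊗ B^{⊗ n(n-1)/2}`. -/
abbrev TensorMatrix (n : ℕ) : Type _ :=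
  (⨂[k] _ : Fin n, A) ⊗[k] (⨂[k] _ : Pair n, B)

/-- `C^n((A,B,ε);A) = Hom_k(A^{⊗ n} ⊗ B^{⊗ n(n-1)/2}, A)` for `n ≥ 0`. -/
abbrev Coch (n : ℕ) : Type _ := TensorMatrix k A B n →ₗ[k] A

variable {k A B} {m n N : ℕ}

/-- The value of a cochain at the tensor matrix with diagonal `a` and upper entries `b`. -/
def Coch.eval (f : Coch k A B n) (a : Fin n → A) (b : Pair n → B) : A :=
  f (PiTensorProduct.tprod k a ⊗ₜ[k] PiTensorProduct.tprod k b)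

variable (k) in
/-- Linearity of a function of the entries of a matrix in each entry separately. -/
structure SepLin (F : (Fin n → A) → (Pair n → B) → A) : Prop where
  left : ∀ a b j, IsLinearMap k fun x => F (Function.update a j x) b
  right : ∀ a b P, IsLinearMap k fun y => F a (Function.update b P y)

/-- The cochain with prescribed values on the pure tensors. -/
noncomputable def Coch.mk (F : (Fin n → A) → (Pair n → B) → A) (hF : SepLin k F) :
    Coch k A B n :=
  TensorProduct.lift <| PiTensorProduct.lift
    { toFun := fun a => PiTensorProduct.lift
        { toFun := fun b => F a b
          map_update_add' := by
            intro _ b P x y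
            convert (hF.right a b P).map_add x y
          map_update_smul' := by
            intro _ b P c x
            convert (hF.right a b P).map_smul c x }
      map_update_add' := by
        intro _ a j x y
        ext b
        simp only [LinearMap.compMultilinearMap_apply, PiTensorProduct.lift.tprod,
          MultilinearMap.coe_mk, LinearMap.add_apply]
        convert (hF.left a b j).map_add x y
      map_update_smul' := by
        intro _ a j c x
        ext b
        simp only [LinearMap.compMultilinearMap_apply, PiTensorProduct.lift.tprod,
          MultilinearMap.coe_mk, LinearMap.smul_apply]
        convert (hF.left a b j).map_smul c x }

@[simp]
theorem Coch.eval_mk (F : (Fin n → A) → (Pair n → B) → A) (hF : SepLin k F)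
    (a : Fin n → A) (b : Pair n → B) : (Coch.mk F hF).eval a b = F a b := by
  simp [Coch.mk, Coch.eval]

theorem Coch.eval_sepLin (f : Coch k A B n) : SepLin k f.eval where
  left a b j := ⟨fun x y => by simp [Coch.eval, TensorProduct.add_tmul],
    fun c x => by
      simp only [Coch.eval, MultilinearMap.map_update_smul, ← TensorProduct.smul_tmul', map_smul]⟩
  right a b P := ⟨fun x y => by simp [Coch.eval, TensorProduct.tmul_add],
    fun c x => by simp [Coch.eval]⟩

theorem window_injective (i n : ℕ) (h : i + n ≤ N) : Function.Injective (window i n h) := by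
  intro x y hxy
  simp only [window, Fin.mk.injEq] at hxy
  exact Fin.ext (by omega)

theorem windowPair_injective (i n : ℕ) (h : i + n ≤ N) :
    Function.Injective (windowPair i n h) := by
  rintro ⟨⟨x, y⟩, _⟩ ⟨⟨x', y'⟩, _⟩ hxy
  simp only [windowPair, Subtype.mk.injEq, Prod.mk.injEq] at hxy ⊢
  exact ⟨window_injective i n h hxy.1, window_injective i n h hxy.2⟩

theorem mem_range_window {i n : ℕ} {h : i + n ≤ N} {j : Fin N} :
    j ∈ Set.range (window i n h) ↔ i ≤ j ∧ (j : ℕ) < i + n := by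
  constructor
  · rintro ⟨t, rfl⟩
    have := t.2
    simp only [window]
    omega
  · rintro ⟨h₁, h₂⟩
    exact ⟨⟨j - i, by omega⟩, Fin.ext (by simp only [window]; omega)⟩

theorem mem_range_windowPair {i n : ℕ} {h : i + n ≤ N} {P : Pair N} :
    P ∈ Set.range (windowPair i n h) ↔ i ≤ P.1.1 ∧ (P.1.2 : ℕ) < i + n := by
  constructor
  · rintro ⟨t, rfl⟩
    have := t.1.2.2
    simp only [windowPair, window]
    omega
  · rintro ⟨h₁, h₂⟩
    have h₃ : (P.1.1 : ℕ) < P.1.2 := P.2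
    refine ⟨⟨(⟨P.1.1 - i, by omega⟩, ⟨P.1.2 - i, by omega⟩), ?_⟩, ?_⟩
    · simp only [Fin.lt_def]; omega
    · refine Subtype.ext (Prod.ext (Fin.ext ?_) (Fin.ext ?_)) <;>
        simp only [windowPair, window] <;> omega

theorem mergeA_eq_update (h : N + 1 = m + n) (i : Fin m) (x : A) (a : Fin N → A) :
    mergeA h i x a = Function.update (mergeA h i 0 a) i x := by
  funext s
  by_cases hs : s = i
  · subst hs; simp [mergeA]
  · simp [mergeA, hs]

theorem mergeA_update_of_mem (h : N + 1 = m + n) (i : Fin m) (x y : A) (a : Fin N → A)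
    (j : Fin N) (hj : i ≤ (j : ℕ) ∧ (j : ℕ) < i + n) :
    mergeA h i x (Function.update a j y) = mergeA h i x a := by
  funext s
  simp only [mergeA]
  split_ifs with h₁ h₂
  · rw [Function.update_of_ne]
    simp only [ne_eq, Fin.ext_iff] at *
    omega
  · rfl
  · rw [Function.update_of_ne]
    simp only [ne_eq, Fin.ext_iff] at *
    omega

theorem mergeA_update_of_notMem (h : N + 1 = m + n) (i : Fin m) (x y : A) (a : Fin N → A)
    (j : Fin N) (hj : ¬ (i ≤ (j : ℕ) ∧ (j : ℕ) < i + n)) :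
    mergeA h i x (Function.update a j y) =
      Function.update (mergeA h i x a) (collapse h i j) y := by
  funext s
  simp only [mergeA, Function.update_apply, collapse, Fin.lt_def, Fin.ext_iff]
  have := s.2
  have := j.2
  split_ifs <;> first | rfl | omega

theorem mergeB_update_of_mem (h : N + 1 = m + n) (i : Fin m) (y : B) (b : Pair N → B)
    (P : Pair N) (hP : i ≤ (P.1.1 : ℕ) ∧ (P.1.2 : ℕ) < i + n) :
    mergeB h i (Function.update b P y) = mergeB h i b := by
  funext Q
  refine Finset.prod_congr rfl fun R hR => ?_
  rw [Function.update_of_ne]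
  rintro rfl
  have h₁ : (R.1.1 : ℕ) < R.1.2 := R.2
  have h₂ : (Q.1.1 : ℕ) < Q.1.2 := Q.2
  simp only [Finset.mem_filter, Finset.mem_univ, true_and, collapse, Fin.ext_iff] at hR
  obtain ⟨h₃, h₄⟩ := hR
  split_ifs at h₃ h₄ <;> omega

theorem mergeB_update_of_notMem (h : N + 1 = m + n) (i : Fin m) (b : Pair N → B)
    (P : Pair N) (hP : ¬ (i ≤ (P.1.1 : ℕ) ∧ (P.1.2 : ℕ) < i + n)) :
    ∃ (Q : Pair m) (c : B), ∀ y,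
      mergeB h i (Function.update b P y) = Function.update (mergeB h i b) Q (y * c) := by
  have h₁ : (P.1.1 : ℕ) < P.1.2 := P.2
  have hlt : collapse h i P.1.1 < collapse h i P.1.2 := by
    simp only [collapse, Fin.lt_def]
    split_ifs <;> omega
  refine ⟨⟨(collapse h i P.1.1, collapse h i P.1.2), hlt⟩,
    ∏ R ∈ (Finset.univ.filter fun R : Pair N => collapse h i R.1.1 = collapse h i P.1.1 ∧
      collapse h i R.1.2 = collapse h i P.1.2).erase P, b R, fun y => ?_⟩
  funext Q
  by_cases hQ : Q = ⟨(collapse h i P.1.1, collapse h i P.1.2), hlt⟩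
  · subst hQ
    rw [Function.update_self, mergeB, ← Finset.mul_prod_erase _ _ (a := P) (by simp),
      Function.update_self]
    congr 1
    refine Finset.prod_congr rfl fun R hR => ?_
    rw [Function.update_of_ne (Finset.ne_of_mem_erase hR)]
  · rw [Function.update_of_ne hQ]
    refine Finset.prod_congr rfl fun R hR => ?_
    rw [Function.update_of_ne]
    rintro rfl
    simp only [Finset.mem_filter, Finset.mem_univ, true_and] at hR
    exact hQ (Subtype.ext (Prod.ext hR.1.symm hR.2.symm))

theorem SepLin.merge (h : N + 1 = m + n) (i : Fin m) (f : Coch k A B m) (g : Coch k A B n) :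
    SepLin k fun (a : Fin N → A) (b : Pair N → B) =>
      f.eval (mergeA h i (g.eval (a ∘ window i n (by omega)) (b ∘ windowPair i n (by omega))) a)
        (mergeB h i b) where
  left a b j := by
    have hw : (i : ℕ) + n ≤ N := by omega
    by_cases hj : i ≤ (j : ℕ) ∧ (j : ℕ) < i + n
    · obtain ⟨t, rfl⟩ := mem_range_window (h := hw) |>.2 hj
      simp only [mergeA_update_of_mem h i _ _ a _ hj,
        Function.update_comp_eq_of_injective _ (window_injective _ _ _)]
      have h₁ := g.eval_sepLin.left (a ∘ window i n (by omega)) (b ∘ windowPair i n (by omega)) t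
      have h₂ := f.eval_sepLin.left (mergeA h i 0 a) (mergeB h i b) i
      simp only [← mergeA_eq_update] at h₂
      exact ⟨fun x y => by rw [h₁.map_add, h₂.map_add], fun c x => by rw [h₁.map_smul, h₂.map_smul]⟩
    · simp only [mergeA_update_of_notMem h i _ _ a _ hj]
      have h₁ : ∀ x, Function.update a j x ∘ window i n (by omega) =
          a ∘ window (N := N) i n (by omega) := fun x =>
        Function.update_comp_eq_of_notMem_range _ _ fun hr => hj (mem_range_window.1 hr)
      simp only [h₁]
      exact f.eval_sepLin.left _ _ _
  right a b P := by
    have hw : (i : ℕ) + n ≤ N := by omega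
    by_cases hP : i ≤ (P.1.1 : ℕ) ∧ (P.1.2 : ℕ) < i + n
    · simp only [mergeB_update_of_mem h i _ b P hP]
      obtain ⟨t, rfl⟩ := mem_range_windowPair (h := hw) |>.2 hP
      simp only [Function.update_comp_eq_of_injective _ (windowPair_injective _ _ _)]
      have h₁ := g.eval_sepLin.right (a ∘ window i n (by omega)) (b ∘ windowPair i n (by omega)) t
      have h₂ := f.eval_sepLin.left (mergeA h i 0 a) (mergeB h i b) i
      simp only [← mergeA_eq_update] at h₂
      exact ⟨fun x y => by rw [h₁.map_add, h₂.map_add], fun c x => by rw [h₁.map_smul, h₂.map_smul]⟩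
    · have h₁ : ∀ y, Function.update b P y ∘ windowPair i n (by omega) =
          b ∘ windowPair (N := N) i n (by omega) := fun x =>
        Function.update_comp_eq_of_notMem_range _ _ fun hr => hP (mem_range_windowPair.1 hr)
      obtain ⟨Q, c, hQ⟩ := mergeB_update_of_notMem h i b P hP
      simp only [h₁, hQ]
      have h₂ := f.eval_sepLin.right (mergeA h i (g.eval (a ∘ window i n (by omega))
        (b ∘ windowPair i n (by omega))) a) (mergeB h i b) Q
      exact ⟨fun x y => by rw [add_mul, h₂.map_add],
        fun r x => by rw [smul_mul_assoc, h₂.map_smul]⟩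

/-- `f ∘_i g`, for `f ∈ C^m`, `g ∈ C^n` and `0 ≤ i ≤ m - 1`, a cochain of degree `m + n - 1`. -/
noncomputable def Coch.circAt (h : N + 1 = m + n) (i : Fin m) (f : Coch k A B m)
    (g : Coch k A B n) : Coch k A B N :=
  Coch.mk (fun a b => f.eval
    (mergeA h i (g.eval (a ∘ window i n (by omega)) (b ∘ windowPair i n (by omega))) a)
    (mergeB h i b)) (SepLin.merge h i f g)

/-- `f ∘ g = ∑_{i=0}^{m-1} (-1)^{(n-1) i} f ∘_i g`. -/
noncomputable def Coch.circ (h : N + 1 = m + n) (f : Coch k A B m) (g : Coch k A B n) :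
    Coch k A B N :=
  ∑ i : Fin m, (((n : ℤ) - 1) * (i : ℤ)).negOnePow • Coch.circAt h i f g

/-- The product of the entries `b_{u,v}` with `u < m ≤ v`. -/
def crossProd (m : ℕ) (b : Pair N → B) : B :=
  ∏ P : Pair N with (P.1.1 : ℕ) < m ∧ m ≤ (P.1.2 : ℕ), b P

theorem crossProd_update_of_mem (m : ℕ) (b : Pair N → B) (P : Pair N)
    (hP : (P.1.1 : ℕ) < m ∧ m ≤ (P.1.2 : ℕ)) :
    ∃ c : B, ∀ y, crossProd m (Function.update b P y) = y * c := by
  refine ⟨∏ R ∈ (Finset.univ.filter fun R : Pair N =>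
    (R.1.1 : ℕ) < m ∧ m ≤ (R.1.2 : ℕ)).erase P, b R, fun y => ?_⟩
  rw [crossProd, ← Finset.mul_prod_erase _ _ (a := P) (by simpa using hP), Function.update_self]
  congr 1
  refine Finset.prod_congr rfl fun R hR => ?_
  rw [Function.update_of_ne (Finset.ne_of_mem_erase hR)]

theorem crossProd_update_of_notMem (m : ℕ) (b : Pair N → B) (P : Pair N)
    (hP : ¬ ((P.1.1 : ℕ) < m ∧ m ≤ (P.1.2 : ℕ))) (y : B) :
    crossProd m (Function.update b P y) = crossProd m b := by
  refine Finset.prod_congr rfl fun R hR => ?_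
  rw [Function.update_of_ne]
  rintro rfl
  simp only [Finset.mem_filter, Finset.mem_univ, true_and] at hR
  exact hP hR

theorem SepLin.cross (ε : B →ₐ[k] A) (β : A → A → A → A)
    (h₁ : ∀ y z, IsLinearMap k fun x => β x y z) (h₂ : ∀ x z, IsLinearMap k fun y => β x y z)
    (h₃ : ∀ x y, IsLinearMap k fun z => β x y z)
    (h : m + n = N) (f : Coch k A B m) (g : Coch k A B n) :
    SepLin k fun (a : Fin N → A) (b : Pair N → B) =>
      β (f.eval (a ∘ window 0 m (by omega)) (b ∘ windowPair 0 m (by omega)))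
        (ε (crossProd m b))
        (g.eval (a ∘ window m n (by omega)) (b ∘ windowPair m n (by omega))) where
  left a b j := by
    have hw : 0 + m ≤ N := by omega
    have hw' : m + n ≤ N := by omega
    by_cases hj : (j : ℕ) < m
    · obtain ⟨t, rfl⟩ := mem_range_window (h := hw) |>.2
        (show 0 ≤ (j : ℕ) ∧ (j : ℕ) < 0 + m by omega)
      have e : ∀ x, Function.update a (window 0 m hw t) x ∘ window m n (by omega) =
          a ∘ window (N := N) m n (by omega) := fun x =>
        Function.update_comp_eq_of_notMem_range _ _ fun hr => by
          have := mem_range_window.1 hr; omega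
      simp only [e, Function.update_comp_eq_of_injective _ (window_injective _ _ _)]
      have l := f.eval_sepLin.left (a ∘ window 0 m (by omega)) (b ∘ windowPair 0 m (by omega)) t
      exact ⟨fun x y => by rw [l.map_add, (h₁ _ _).map_add],
        fun c x => by rw [l.map_smul, (h₁ _ _).map_smul]⟩
    · obtain ⟨t, rfl⟩ := mem_range_window (h := hw') |>.2
        (show m ≤ (j : ℕ) ∧ (j : ℕ) < m + n by omega)
      have e : ∀ x, Function.update a (window m n hw' t) x ∘ window 0 m (by omega) =
          a ∘ window (N := N) 0 m (by omega) := fun x =>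
        Function.update_comp_eq_of_notMem_range _ _ fun hr => by
          have := mem_range_window.1 hr; omega
      simp only [e, Function.update_comp_eq_of_injective _ (window_injective _ _ _)]
      have l := g.eval_sepLin.left (a ∘ window m n (by omega)) (b ∘ windowPair m n (by omega)) t
      exact ⟨fun x y => by rw [l.map_add, (h₃ _ _).map_add],
        fun c x => by rw [l.map_smul, (h₃ _ _).map_smul]⟩
  right a b P := by
    have hw : 0 + m ≤ N := by omega
    have hw' : m + n ≤ N := by omega
    have hlt : (P.1.1 : ℕ) < P.1.2 := P.2
    by_cases hP : (P.1.1 : ℕ) < m ∧ m ≤ (P.1.2 : ℕ)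
    · have e₁ : ∀ y, Function.update b P y ∘ windowPair 0 m (by omega) =
          b ∘ windowPair (N := N) 0 m (by omega) := fun x =>
        Function.update_comp_eq_of_notMem_range _ _ fun hr => by
          have := mem_range_windowPair.1 hr; omega
      have e₂ : ∀ y, Function.update b P y ∘ windowPair m n (by omega) =
          b ∘ windowPair (N := N) m n (by omega) := fun x =>
        Function.update_comp_eq_of_notMem_range _ _ fun hr => by
          have := mem_range_windowPair.1 hr; omega
      obtain ⟨c, hc⟩ := crossProd_update_of_mem m b P hP
      simp only [e₁, e₂, hc]
      exact ⟨fun x y => by rw [add_mul, map_add, (h₂ _ _).map_add],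
        fun r x => by rw [smul_mul_assoc, map_smul, (h₂ _ _).map_smul]⟩
    · simp only [crossProd_update_of_notMem m b P hP]
      by_cases hP' : (P.1.2 : ℕ) < m
      · obtain ⟨t, rfl⟩ := mem_range_windowPair (h := hw) |>.2
          (show 0 ≤ (P.1.1 : ℕ) ∧ (P.1.2 : ℕ) < 0 + m by omega)
        have e : ∀ x, Function.update b (windowPair 0 m hw t) x ∘
            windowPair m n (by omega) = b ∘ windowPair (N := N) m n (by omega) := fun x =>
          Function.update_comp_eq_of_notMem_range _ _ fun hr => by
            have := mem_range_windowPair.1 hr; omega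
        simp only [e, Function.update_comp_eq_of_injective _ (windowPair_injective _ _ _)]
        have l := f.eval_sepLin.right (a ∘ window 0 m (by omega))
          (b ∘ windowPair 0 m (by omega)) t
        exact ⟨fun x y => by rw [l.map_add, (h₁ _ _).map_add],
          fun c x => by rw [l.map_smul, (h₁ _ _).map_smul]⟩
      · have := P.1.2.2
        obtain ⟨t, rfl⟩ := mem_range_windowPair (h := hw') |>.2
          (show m ≤ (P.1.1 : ℕ) ∧ (P.1.2 : ℕ) < m + n by omega)
        have e : ∀ x, Function.update b (windowPair m n hw' t) x ∘
            windowPair 0 m (by omega) = b ∘ windowPair (N := N) 0 m (by omega) := fun x =>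
          Function.update_comp_eq_of_notMem_range _ _ fun hr => by
            have := mem_range_windowPair.1 hr; omega
        simp only [e, Function.update_comp_eq_of_injective _ (windowPair_injective _ _ _)]
        have l := g.eval_sepLin.right (a ∘ window m n (by omega))
          (b ∘ windowPair m n (by omega)) t
        exact ⟨fun x y => by rw [l.map_add, (h₃ _ _).map_add],
          fun c x => by rw [l.map_smul, (h₃ _ _).map_smul]⟩

/-- The cup product of `f ∈ C^m` and `g ∈ C^n`:
`f(T^0_m) · ∏_{i ≤ m < j} ε(b_{i,j}) · g(T^m_{m+n})` (indices from `1`). -/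
noncomputable def Coch.cup (ε : B →ₐ[k] A) (h : m + n = N) (f : Coch k A B m)
    (g : Coch k A B n) : Coch k A B N :=
  Coch.mk (fun a b =>
    f.eval (a ∘ window 0 m (by omega)) (b ∘ windowPair 0 m (by omega)) * ε (crossProd m b) *
      g.eval (a ∘ window m n (by omega)) (b ∘ windowPair m n (by omega)))
    (SepLin.cross ε (fun x y z => x * y * z)
      (fun _ _ => ⟨fun _ _ => by simp only [add_mul], fun _ _ => by simp only [smul_mul_assoc]⟩)
      (fun _ _ => ⟨fun _ _ => by simp only [add_mul, mul_add], fun _ _ => by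
        simp only [smul_mul_assoc, mul_smul_comm]⟩)
      (fun _ _ => ⟨fun _ _ => by simp only [mul_add], fun _ _ => by
        simp only [mul_smul_comm]⟩) h f g)

/-- The identity of `A` as a cochain of degree one. -/
noncomputable def Coch.one : Coch k A B 1 :=
  Coch.mk (fun a _ => a 0)
    ⟨fun a b j => by
      rw [Subsingleton.elim j 0]
      exact ⟨fun x y => by simp, fun c x => by simp⟩,
    fun a b P => absurd P.2 (by rw [Subsingleton.elim P.1.1 P.1.2]; exact lt_irrefl _)⟩

/-- The cochain `a₁ ⊗ a₂ ⊗ b ↦ ε(b) a₁ a₂` of degree two. -/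
noncomputable def Coch.mulCoch (ε : B →ₐ[k] A) : Coch k A B 2 :=
  Coch.mk (fun a b => ε (b ⟨(0, 1), by decide⟩) * a 0 * a 1)
    ⟨fun a b j => by
      fin_cases j
      · exact ⟨fun x y => by simp [mul_add, add_mul], fun c x => by simp⟩
      · exact ⟨fun x y => by simp [mul_add], fun c x => by simp⟩,
    fun a b P => by
      have hP : P = ⟨(0, 1), by decide⟩ := by
        obtain ⟨⟨x, y⟩, h⟩ := P
        simp only [Fin.lt_def] at h
        refine Subtype.ext (Prod.ext (Fin.ext ?_) (Fin.ext ?_)) <;> simp <;> omega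
      subst hP
      exact ⟨fun x y => by simp [add_mul], fun c x => by simp⟩⟩

/-- The first term of the differential: `T ↦ a_1 ε(b_{1,2} ⋯ b_{1,n+1}) f(T^1_{n+1})`
(indices from `1`). -/
noncomputable def Coch.deltaFirst (ε : B →ₐ[k] A) (f : Coch k A B n) : Coch k A B (n + 1) :=
  Coch.mk (fun a b => a 0 * ε (crossProd 1 b) *
      f.eval (a ∘ window 1 n (by omega)) (b ∘ windowPair 1 n (by omega))) <| by
    have := SepLin.cross ε (fun x y z => x * y * z)
      (fun _ _ => ⟨fun _ _ => by simp only [add_mul], fun _ _ => by simp only [smul_mul_assoc]⟩)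
      (fun _ _ => ⟨fun _ _ => by simp only [add_mul, mul_add], fun _ _ => by
        simp only [smul_mul_assoc, mul_smul_comm]⟩)
      (fun _ _ => ⟨fun _ _ => by simp only [mul_add], fun _ _ => by
        simp only [mul_smul_comm]⟩) (show 1 + n = n + 1 by omega) (Coch.one (k := k)) f
    have e : window (N := n + 1) 0 1 (by omega) 0 = 0 := rfl
    simpa only [Coch.one, Coch.eval_mk, Function.comp_apply, e] using this

/-- The middle terms of the differential: `T ↦ f(M_{i,i+1})`, where the matrix `M_{i,i+1}` is
obtained from `T` by merging the indices `i` and `i + 1`, with diagonal entry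
`ε(b_{i,i+1}) a_i a_{i+1}`. -/
noncomputable def Coch.deltaMiddle (ε : B →ₐ[k] A) (f : Coch k A B n) (i : Fin n) :
    Coch k A B (n + 1) :=
  Coch.mk (fun a b => f.eval
      (mergeA (n := 2) rfl i
        (ε (b ⟨(i.castSucc, i.succ), Fin.castSucc_lt_succ⟩) * a i.castSucc * a i.succ) a)
      (mergeB (n := 2) rfl i b)) <| by
    have := SepLin.merge (show n + 1 + 1 = n + 2 from rfl) i f (Coch.mulCoch ε)
    have e₀ : window (N := n + 1) i 2 (by omega) 0 = i.castSucc := rfl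
    have e₁ : window (N := n + 1) i 2 (by omega) 1 = i.succ := rfl
    simpa only [Coch.mulCoch, Coch.eval_mk, Function.comp_apply, windowPair, e₀, e₁] using this

/-- The last term of the differential, without its sign:
`T ↦ f(T^0_n) a_{n+1} ε(b_{1,n+1} ⋯ b_{n,n+1})` (indices from `1`). -/
noncomputable def Coch.deltaLast (ε : B →ₐ[k] A) (f : Coch k A B n) : Coch k A B (n + 1) :=
  Coch.mk (fun a b => f.eval (a ∘ window 0 n (by omega)) (b ∘ windowPair 0 n (by omega)) *
      a (Fin.last n) * ε (crossProd n b)) <| by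
    have := SepLin.cross ε (fun x y z => x * z * y)
      (fun _ _ => ⟨fun _ _ => by simp only [add_mul], fun _ _ => by simp only [smul_mul_assoc]⟩)
      (fun _ _ => ⟨fun _ _ => by simp only [mul_add], fun _ _ => by
        simp only [mul_smul_comm]⟩)
      (fun _ _ => ⟨fun _ _ => by simp only [add_mul, mul_add], fun _ _ => by
        simp only [smul_mul_assoc, mul_smul_comm]⟩) (show n + 1 = n + 1 from rfl) f
      (Coch.one (k := k))
    have e : window (N := n + 1) n 1 (by omega) 0 = Fin.last n := rfl
    simpa only [Coch.one, Coch.eval_mk, Function.comp_apply, e] using this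

/-- The differential `δ^ε : C^n → C^{n+1}`. -/
noncomputable def Coch.delta (ε : B →ₐ[k] A) (f : Coch k A B n) : Coch k A B (n + 1) :=
  f.deltaFirst ε + ∑ i : Fin n, ((i : ℤ) + 1).negOnePow • f.deltaMiddle ε i +
    ((n : ℤ) + 1).negOnePow • f.deltaLast ε

end Cochains

section Graded

variable (k A B : Type*) [Field k] [Ring A] [Algebra k A] [CommRing B] [Algebra k B]

/-- The cochain groups in all integer degrees, with `C^n = 0` for `n < 0`. -/
def Cochain : ℤ → Type _
  | Int.ofNat n => Coch k A B n
  | Int.negSucc _ => PUnit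

noncomputable instance : ∀ n : ℤ, AddCommGroup (Cochain k A B n)
  | Int.ofNat n => inferInstanceAs (AddCommGroup (Coch k A B n))
  | Int.negSucc _ => inferInstanceAs (AddCommGroup PUnit)

variable {k A B}

-- In the three operations below, the degree of the result is given up to an equality of integers.

/-- `∘ : C^m × C^n → C^{m+n-1}`. -/
noncomputable def circ : {m n p : ℤ} → p + 1 = m + n → Cochain k A B m → Cochain k A B n →
    Cochain k A B p
  | Int.ofNat _, Int.ofNat _, Int.ofNat _, h, f, g =>
    Coch.circ (by simp only [Int.ofNat_eq_natCast] at h; omega) f g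
  | _, _, _, _, _, _ => 0

/-- `⌣ : C^m × C^n → C^{m+n}`. -/
noncomputable def cup (ε : B →ₐ[k] A) : {m n p : ℤ} → m + n = p → Cochain k A B m →
    Cochain k A B n → Cochain k A B p
  | Int.ofNat _, Int.ofNat _, Int.ofNat _, h, f, g =>
    Coch.cup ε (by simp only [Int.ofNat_eq_natCast] at h; omega) f g
  | _, _, _, _, _, _ => 0

/-- `δ^ε : C^n → C^{n+1}`. -/
noncomputable def delta (ε : B →ₐ[k] A) : {n p : ℤ} → n + 1 = p → Cochain k A B n →
    Cochain k A B p
  | Int.ofNat n, _, h, f => h ▸ (show Cochain k A B (Int.ofNat (n + 1)) from Coch.delta ε f)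
  | Int.negSucc _, _, _, _ => 0

end Graded

end SecondaryHochschild

/-!
The insertions `∘_i` satisfy the relations of an operad. Hence the associator
`(f ∘ g) ∘ e - f ∘ (g ∘ e)` is the sum of the two ways to insert `g` and `e` side by side into `f`,
and is graded symmetric in `g` and `e` (the pre-Lie identity). Let `μ ∈ C²` be the cochain
`a₁ ⊗ a₂ ⊗ b ↦ ε(b) a₁ a₂`. As `ε` is central, `δ f = (-1)^{n-1} μ ∘ f - f ∘ μ` for `f ∈ C^n`.
Substituting this expresses the left-hand side through the associators of `f`, `g`, `μ` with `f` or
`μ` in front. The two that start with `f` cancel by the pre-Lie identity, and the one that starts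
with `μ` consists of `μ` with `f` and `g` inserted into its two arguments in either order, which are
the cup products, again because `ε` is central.
-/

namespace SecondaryHochschild

section SignedSums

theorem map_intUnits_smul {X Y : Type*} [AddCommGroup X] [AddCommGroup Y] (φ : X →+ Y) (u : ℤˣ)
    (x : X) : φ (u • x) = u • φ x := by
  simp only [Units.smul_def, map_zsmul]

theorem map_sum_intUnits_smul {ι X Y : Type*} [Fintype ι] [AddCommGroup X] [AddCommGroup Y]
    (φ : X →+ Y) (u : ι → ℤˣ) (x : ι → X) : φ (∑ i, u i • x i) = ∑ i, u i • φ (x i) := by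
  simp only [map_sum, map_intUnits_smul]

theorem sum_sum_eq_sum_window_add_sum_pair {X : Type*} [AddCommMonoid X] {m n M : ℕ}
    (h : M + 1 = m + n) (G : Fin m → Fin M → X) :
    ∑ i, ∑ j, G i j =
      ∑ i : Fin m, ∑ l : Fin n, G i ⟨i + l, by omega⟩ +
        ∑ P : Pair m, G P.1.1 ⟨P.1.2 + n - 1, by have := P.2; omega⟩ +
        ∑ P : Pair m, G P.1.2 ⟨P.1.1, by have := P.2; omega⟩ := by
  let φ : ((Fin m × Fin n) ⊕ Pair m) ⊕ Pair m → Fin m × Fin M :=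
    Sum.elim (Sum.elim (fun x => (x.1, ⟨x.1 + x.2, by omega⟩))
      fun P => (P.1.1, ⟨P.1.2 + n - 1, by have := P.2; omega⟩))
      fun P => (P.1.2, ⟨P.1.1, by have := P.2; omega⟩)
  have hφ : φ.Bijective := by
    constructor
    · rintro ((⟨i, l⟩ | ⟨⟨i, j⟩, hij⟩) | ⟨⟨j, i⟩, hji⟩)
        ((⟨i', l'⟩ | ⟨⟨i', j'⟩, hij'⟩) | ⟨⟨j', i'⟩, hji'⟩) <;>
      grind
    · rintro ⟨i, j⟩
      rcases lt_or_ge (j : ℕ) i with hji | hij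
      · exact ⟨.inr ⟨(⟨j, by omega⟩, i), hji⟩, rfl⟩
      rcases lt_or_ge (j : ℕ) (i + n) with hj | hj
      · exact ⟨.inl (.inl (i, ⟨j - i, by omega⟩)), by simp [φ, hij]⟩
      · exact ⟨.inl (.inr ⟨(i, ⟨j + 1 - n, by omega⟩), by simp only [Fin.lt_def]; omega⟩),
          Prod.ext rfl (Fin.ext (by simp only [φ, Sum.elim_inl, Sum.elim_inr]; omega))⟩
  rw [← Fintype.sum_prod_type', ← hφ.sum_comp, Fintype.sum_sum_type, Fintype.sum_sum_type,
    Fintype.sum_prod_type]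
  rfl

end SignedSums

section Push

variable {B : Type*} [CommMonoid B] {M N K : ℕ}

/-- The pushforward of the entries above the diagonal along a map `φ` of indices: entries are
multiplied over the fibres of `φ`, and those whose row and column have the same image are dropped.
Both `mergeB` and `crossProd` are of this form, so that iterated merging becomes composition. -/
def pushB (φ : Fin N → Fin M) (b : Pair N → B) (Q : Pair M) : B :=
  ∏ P : Pair N with φ P.1.1 = Q.1.1 ∧ φ P.1.2 = Q.1.2, b P

theorem mergeB_eq_pushB {m n : ℕ} (h : N + 1 = m + n) (i : Fin m) :
    mergeB (B := B) h i = pushB (collapse h i) := rfl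

theorem crossProd_eq_pushB {R : Type*} [CommRing R] {φ : Fin N → Fin 2} {c : ℕ}
    (hφ : ∀ t, φ t = 0 ↔ (t : ℕ) < c) (b : Pair N → R) :
    crossProd c b = pushB φ b ⟨(0, 1), by decide⟩ := by
  refine Finset.prod_congr (Finset.filter_congr fun P _ => ?_) fun _ _ => rfl
  have eq_one_iff : ∀ x : Fin 2, x = 1 ↔ ¬x = 0 := by decide
  rw [eq_one_iff, hφ, hφ, not_lt]

theorem pushB_id (b : Pair N → B) : pushB id b = b := by
  funext Q
  simp only [pushB, id, ← Prod.ext_iff, ← Subtype.ext_iff, Finset.filter_eq', Finset.mem_univ,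
    if_true, Finset.prod_singleton]

theorem pushB_pushB {φ : Fin N → Fin M} (hφ : Monotone φ) (ψ : Fin M → Fin K) (b : Pair N → B) :
    pushB ψ (pushB φ b) = pushB (ψ ∘ φ) b := by
  funext Q
  simp only [pushB, Finset.prod_sigma']
  refine Finset.prod_bij (fun RP _ => RP.2) ?_ ?_ ?_ fun _ _ => rfl
  · rintro ⟨R, P⟩ h
    simp only [Finset.mem_sigma, Finset.mem_filter, Finset.mem_univ, true_and] at h ⊢
    simpa only [Function.comp_apply, h.2.1, h.2.2] using h.1
  · rintro ⟨R, P⟩ h ⟨R', P'⟩ h' rfl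
    simp only [Finset.mem_sigma, Finset.mem_filter, Finset.mem_univ, true_and] at h h'
    obtain rfl : R = R' := Subtype.ext (Prod.ext (h.2.1.symm.trans h'.2.1)
      (h.2.2.symm.trans h'.2.2))
    rfl
  · intro P hP
    simp only [Finset.mem_filter, Finset.mem_univ, true_and, Function.comp_apply] at hP
    have hlt : φ P.1.1 < φ P.1.2 :=
      (hφ P.2.le).lt_of_ne fun he => Q.2.ne (by rw [← hP.1, ← hP.2, he])
    exact ⟨⟨⟨(φ P.1.1, φ P.1.2), hlt⟩, P⟩, by simpa using hP, rfl⟩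

theorem pushB_comp_windowPair {i i' n n' : ℕ} (hw : i + n ≤ N) (hw' : i' + n' ≤ M)
    (φ : Fin N → Fin M) (φ' : Fin n → Fin n') (b : Pair N → B)
    (hφ : ∀ t s, φ t = window i' n' hw' s ↔ ∃ u, window i n hw u = t ∧ φ' u = s) :
    pushB φ b ∘ windowPair i' n' hw' = pushB φ' (b ∘ windowPair i n hw) := by
  funext Q
  symm
  refine Finset.prod_bij (fun R _ => windowPair i n hw R) ?_
    (fun R _ R' _ h => windowPair_injective i n hw h) ?_ (fun _ _ => rfl)
  · intro R hR
    simp only [Finset.mem_filter, Finset.mem_univ, true_and] at hR ⊢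
    exact ⟨(hφ _ _).2 ⟨_, rfl, hR.1⟩, (hφ _ _).2 ⟨_, rfl, hR.2⟩⟩
  · intro P hP
    simp only [Finset.mem_filter, Finset.mem_univ, true_and] at hP
    obtain ⟨u, hu, hu'⟩ := (hφ _ _).1 hP.1
    obtain ⟨v, hv, hv'⟩ := (hφ _ _).1 hP.2
    have huv : u < v := by
      have hP := P.2
      rw [← hu, ← hv] at hP
      simpa only [window, Fin.lt_def, add_lt_add_iff_left] using hP
    exact ⟨⟨(u, v), huv⟩, by simpa using ⟨hu', hv'⟩, Subtype.ext (Prod.ext hu hv)⟩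

end Push

section Merge

variable {A B : Type*} [CommMonoid B] {m n p K M M' N : ℕ}

theorem window_comp_window {i j : ℕ} (h : i + n ≤ N) (h' : j + p ≤ n) :
    window i n h ∘ window j p h' = window (i + j) p (by omega) :=
  funext fun _ => Fin.ext (by simp only [Function.comp_apply, window, add_assoc])

theorem windowPair_comp_windowPair {i j : ℕ} (h : i + n ≤ N) (h' : j + p ≤ n) :
    windowPair i n h ∘ windowPair j p h' = windowPair (i + j) p (by omega) :=
  funext fun _ => Subtype.ext <| Prod.ext (congrFun (window_comp_window h h') _)
    (congrFun (window_comp_window h h') _)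

theorem collapse_monotone (h : N + 1 = m + n) (i : Fin m) : Monotone (collapse (N := N) h i) := by
  intro s t hst
  simp only [Fin.le_def, collapse] at hst ⊢
  split_ifs <;> omega

theorem collapse_comp_collapse_of_mem (h₁ : M + 1 = m + n) (h₂ : N + 1 = M + p)
    (h₃ : N + 1 = m + K) (i : Fin m) (l : Fin n) :
    collapse h₁ i ∘ collapse h₂ ⟨i + l, by omega⟩ = collapse h₃ i := by
  funext t
  simp only [collapse, Fin.ext_iff, Function.comp_apply]
  split_ifs <;> omega

theorem collapse_comp_collapse_of_lt (h₁ : M + 1 = m + n) (h₂ : N + 1 = M + p)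
    (h₃ : M' + 1 = m + p) (h₄ : N + 1 = M' + n) {i j : Fin m} (hij : i < j) :
    collapse h₁ i ∘ collapse h₂ ⟨j + n - 1, by omega⟩ =
      collapse h₃ j ∘ collapse h₄ ⟨i, by omega⟩ := by
  funext t
  simp only [collapse, Fin.ext_iff, Function.comp_apply]
  split_ifs <;> omega

theorem mergeA_mergeA_of_mem (h₁ : M + 1 = m + n) (h₂ : N + 1 = M + p) (h₃ : N + 1 = m + K)
    (i : Fin m) (l : Fin n) (x y : A) (a : Fin N → A) :
    mergeA h₁ i x (mergeA h₂ ⟨i + l, by omega⟩ y a) = mergeA h₃ i x a := by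
  funext s
  simp only [mergeA, Fin.lt_def, Fin.ext_iff]
  grind

theorem mergeB_mergeB_of_mem (h₁ : M + 1 = m + n) (h₂ : N + 1 = M + p) (h₃ : N + 1 = m + K)
    (i : Fin m) (l : Fin n) (b : Pair N → B) :
    mergeB h₁ i (mergeB h₂ ⟨i + l, by omega⟩ b) = mergeB h₃ i b := by
  simp only [mergeB_eq_pushB]
  rw [pushB_pushB (collapse_monotone h₂ _), collapse_comp_collapse_of_mem h₁ h₂ h₃]

theorem mergeA_comp_window_of_mem (h₁ : N + 1 = M + p) (h₂ : K + 1 = n + p) {i : ℕ}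
    (hi : i + n ≤ M) (l : Fin n) (y : A) (a : Fin N → A) :
    mergeA h₁ ⟨i + l, by omega⟩ y a ∘ window i n hi =
      mergeA h₂ l y (a ∘ window i K (by omega)) := by
  funext s
  simp only [mergeA, Fin.lt_def, Fin.ext_iff, Function.comp_apply, window]
  grind

theorem mergeB_comp_windowPair_of_mem (h₁ : N + 1 = M + p) (h₂ : K + 1 = n + p) {i : ℕ}
    (hi : i + n ≤ M) (l : Fin n) (b : Pair N → B) :
    mergeB h₁ ⟨i + l, by omega⟩ b ∘ windowPair i n hi =
      mergeB h₂ l (b ∘ windowPair i K (by omega)) := by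
  simp only [mergeB_eq_pushB]
  refine pushB_comp_windowPair _ _ _ _ _ fun t s => ?_
  constructor
  · intro hts
    simp only [collapse, window, Fin.ext_iff] at hts
    refine ⟨⟨t - i, by split_ifs at hts <;> omega⟩, Fin.ext ?_, Fin.ext ?_⟩ <;>
      simp only [collapse, window] <;> split_ifs at hts ⊢ <;> omega
  · rintro ⟨u, rfl, rfl⟩
    simp only [collapse, window, Fin.ext_iff, add_assoc, add_lt_add_iff_left]
    split_ifs <;> omega

theorem mergeA_mergeA_of_lt (h₁ : M + 1 = m + n) (h₂ : N + 1 = M + p) (h₃ : M' + 1 = m + p)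
    (h₄ : N + 1 = M' + n) {i j : Fin m} (hij : i < j) (x y : A) (a : Fin N → A) :
    mergeA h₁ i x (mergeA h₂ ⟨j + n - 1, by omega⟩ y a) =
      mergeA h₃ j y (mergeA h₄ ⟨i, by omega⟩ x a) := by
  funext s
  simp only [mergeA, Fin.lt_def, Fin.ext_iff] at hij ⊢
  grind

theorem mergeB_mergeB_of_lt (h₁ : M + 1 = m + n) (h₂ : N + 1 = M + p) (h₃ : M' + 1 = m + p)
    (h₄ : N + 1 = M' + n) {i j : Fin m} (hij : i < j) (b : Pair N → B) :
    mergeB h₁ i (mergeB h₂ ⟨j + n - 1, by omega⟩ b) =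
      mergeB h₃ j (mergeB h₄ ⟨i, by omega⟩ b) := by
  simp only [mergeB_eq_pushB]
  rw [pushB_pushB (collapse_monotone h₂ _), pushB_pushB (collapse_monotone h₄ _),
    collapse_comp_collapse_of_lt h₁ h₂ h₃ h₄ hij]

theorem mergeA_comp_window_of_le (h : N + 1 = M + p) {j : Fin M} {i : ℕ} (hij : i + n ≤ j) (y : A)
    (a : Fin N → A) :
    mergeA h j y a ∘ window i n (by omega) = a ∘ window i n (by omega) := by
  funext s
  simp only [mergeA, Fin.lt_def, Fin.ext_iff, Function.comp_apply, window]
  grind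

theorem mergeB_comp_windowPair_of_le (h : N + 1 = M + p) {j : Fin M} {i : ℕ} (hij : i + n ≤ j)
    (b : Pair N → B) :
    mergeB h j b ∘ windowPair i n (by omega) = b ∘ windowPair i n (by omega) := by
  rw [mergeB_eq_pushB, pushB_comp_windowPair (i := i) (by omega) (by omega) _ id b, pushB_id]
  intro t s
  simp only [id, exists_eq_right]
  simp only [Fin.ext_iff, collapse, window]
  split_ifs <;> omega

theorem mergeA_comp_window_of_lt (h : N + 1 = M + p) {j : Fin M} {i : ℕ} (hji : j < i)
    (hi : i + n ≤ M) (y : A) (a : Fin N → A) :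
    mergeA h j y a ∘ window i n hi = a ∘ window (i + p - 1) n (by omega) := by
  funext s
  simp only [mergeA, Fin.lt_def, Fin.ext_iff, Function.comp_apply, window]
  grind

theorem mergeB_comp_windowPair_of_lt (h : N + 1 = M + p) {j : Fin M} {i : ℕ} (hji : j < i)
    (hi : i + n ≤ M) (b : Pair N → B) :
    mergeB h j b ∘ windowPair i n hi = b ∘ windowPair (i + p - 1) n (by omega) := by
  rw [mergeB_eq_pushB, pushB_comp_windowPair (i := i + p - 1) (by omega) (by omega) _ id b,
    pushB_id]
  intro t s
  simp only [id, exists_eq_right]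
  simp only [Fin.ext_iff, collapse, window]
  split_ifs <;> omega

end Merge

section Operad

variable {k A B : Type*} [Field k] [Ring A] [Algebra k A] [CommRing B] [Algebra k B]
variable {m n p K M M' N : ℕ}

theorem Coch.ext_eval {f g : Coch k A B n} (h : ∀ a b, f.eval a b = g.eval a b) : f = g := by
  ext a b
  exact h a b

theorem Coch.eval_add (f g : Coch k A B n) (a : Fin n → A) (b : Pair n → B) :
    (f + g).eval a b = f.eval a b + g.eval a b := rfl

theorem Coch.eval_circAt (h : N + 1 = m + n) (i : Fin m) (f : Coch k A B m) (g : Coch k A B n)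
    (a : Fin N → A) (b : Pair N → B) :
    (circAt h i f g).eval a b = f.eval
      (mergeA h i (g.eval (a ∘ window i n (by omega)) (b ∘ windowPair i n (by omega))) a)
      (mergeB h i b) :=
  eval_mk _ _ a b

theorem Coch.circAt_circAt_of_mem (h₁ : M + 1 = m + n) (h₂ : N + 1 = M + p) (h₃ : K + 1 = n + p)
    (h₄ : N + 1 = m + K) (i : Fin m) (l : Fin n)
    (f : Coch k A B m) (g : Coch k A B n) (e : Coch k A B p) :
    circAt h₂ ⟨i + l, by omega⟩ (circAt h₁ i f g) e = circAt h₄ i f (circAt h₃ l g e) := by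
  refine ext_eval fun a b => ?_
  simp only [eval_circAt]
  rw [mergeA_mergeA_of_mem h₁ h₂ h₄, mergeB_mergeB_of_mem h₁ h₂ h₄,
    mergeA_comp_window_of_mem h₂ h₃, mergeB_comp_windowPair_of_mem h₂ h₃]
  simp only [Function.comp_assoc, window_comp_window, windowPair_comp_windowPair]

theorem Coch.circAt_circAt_of_lt (h₁ : M + 1 = m + n) (h₂ : N + 1 = M + p) (h₃ : M' + 1 = m + p)
    (h₄ : N + 1 = M' + n) {i j : Fin m} (hij : i < j)
    (f : Coch k A B m) (g : Coch k A B n) (e : Coch k A B p) :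
    circAt h₂ ⟨j + n - 1, by omega⟩ (circAt h₁ i f g) e =
      circAt h₄ ⟨i, by omega⟩ (circAt h₃ j f e) g := by
  have hij' : (i : ℕ) < j := hij
  refine ext_eval fun a b => ?_
  simp only [eval_circAt]
  rw [mergeA_mergeA_of_lt h₁ h₂ h₃ h₄ hij, mergeB_mergeB_of_lt h₁ h₂ h₃ h₄ hij,
    mergeA_comp_window_of_le h₂ (by simp only; omega),
    mergeB_comp_windowPair_of_le h₂ (by simp only; omega),
    mergeA_comp_window_of_lt h₄ hij', mergeB_comp_windowPair_of_lt h₄ hij']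

theorem Coch.circAt_add_left (h : N + 1 = m + n) (i : Fin m) (f f' : Coch k A B m)
    (g : Coch k A B n) : circAt h i (f + f') g = circAt h i f g + circAt h i f' g :=
  ext_eval fun a b => by simp only [eval_circAt, eval_add]

theorem Coch.circAt_add_right (h : N + 1 = m + n) (i : Fin m) (f : Coch k A B m)
    (g g' : Coch k A B n) : circAt h i f (g + g') = circAt h i f g + circAt h i f g' := by
  refine ext_eval fun a b => ?_
  have hf := (f.eval_sepLin.left (mergeA h i 0 a) (mergeB h i b) i).map_add
  simp only [← mergeA_eq_update] at hf
  simp only [eval_add, eval_circAt, hf]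

/-- The partial composition `∘_i` as a biadditive map. -/
noncomputable def Coch.circAtHom (h : N + 1 = m + n) (i : Fin m) :
    Coch k A B m →+ Coch k A B n →+ Coch k A B N :=
  .mk' (fun f => .mk' (circAt h i f) (circAt_add_right h i f))
    fun f f' => AddMonoidHom.ext (circAt_add_left h i f f')

theorem Coch.circ_add_left (h : N + 1 = m + n) (f f' : Coch k A B m) (g : Coch k A B n) :
    circ h (f + f') g = circ h f g + circ h f' g := by
  simp only [circ, circAt_add_left, smul_add, Finset.sum_add_distrib]

theorem Coch.circ_add_right (h : N + 1 = m + n) (f : Coch k A B m) (g g' : Coch k A B n) :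
    circ h f (g + g') = circ h f g + circ h f g' := by
  simp only [circ, circAt_add_right, smul_add, Finset.sum_add_distrib]

end Operad

section Brace

variable {k A B : Type*} [Field k] [Ring A] [Algebra k A] [CommRing B] [Algebra k B]
variable {m n p K M N : ℕ}

/-- The brace operation `f{g, e}`: the signed sum of all insertions of `g` and `e` into different
arguments of `f`, with `g` to the left of `e`. -/
noncomputable def Coch.brace (h : N + 2 = m + n + p) (f : Coch k A B m) (g : Coch k A B n)
    (e : Coch k A B p) : Coch k A B N :=
  ∑ P : Pair m, (((n : ℤ) - 1) * (P.1.1 : ℤ) + ((p : ℤ) - 1) * ((P.1.2 : ℤ) + n - 1)).negOnePow •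
    circAt (m := m + n - 1) (by have := P.2; omega)
      ⟨P.1.2 + n - 1, by have := P.2; omega⟩ (circAt (by have := P.2; omega) P.1.1 f g) e

/-- The terms of `(f ∘ g) ∘ e` in which `e` is inserted into an argument of `g`. They add up to
`f ∘ (g ∘ e)` whenever `g ∘ e` has nonnegative degree. -/
noncomputable def Coch.circNested (h₁ : M + 1 = m + n) (h₂ : N + 1 = M + p) (f : Coch k A B m)
    (g : Coch k A B n) (e : Coch k A B p) : Coch k A B N :=
  ∑ i : Fin m, ∑ l : Fin n, (((n : ℤ) - 1) * (i : ℤ) + ((p : ℤ) - 1) * ((i : ℤ) + l)).negOnePow •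
    circAt h₂ ⟨i + l, by omega⟩ (circAt h₁ i f g) e

theorem Coch.circ_circ_right (h₁ : M + 1 = m + n) (h₂ : N + 1 = M + p) (h₃ : K + 1 = n + p)
    (h₄ : N + 1 = m + K) (f : Coch k A B m) (g : Coch k A B n) (e : Coch k A B p) :
    circ h₄ f (circ h₃ g e) = circNested h₁ h₂ f g e := by
  refine Finset.sum_congr rfl fun i _ => ?_
  have hi : circAt h₄ i f (circ h₃ g e) =
      ∑ l : Fin n, (((p : ℤ) - 1) * (l : ℤ)).negOnePow • circAt h₄ i f (circAt h₃ l g e) :=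
    map_sum_intUnits_smul (circAtHom h₄ i f) _ _
  rw [hi, Finset.smul_sum]
  refine Finset.sum_congr rfl fun l _ => ?_
  rw [circAt_circAt_of_mem h₁ h₂ h₃ h₄, smul_smul, ← Int.negOnePow_add]
  congr 2
  have hK : (K : ℤ) = n + p - 1 := by omega
  rw [hK]
  ring

theorem Coch.circ_circ_left (h₁ : M + 1 = m + n) (h₂ : N + 1 = M + p)
    (f : Coch k A B m) (g : Coch k A B n) (e : Coch k A B p) :
    circ h₂ (circ h₁ f g) e = circNested h₁ h₂ f g e + brace (by omega) f g e +
      (((n : ℤ) - 1) * ((p : ℤ) - 1)).negOnePow • brace (by omega) f e g := by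
  have hfg (j : Fin M) : circAt h₂ j (circ h₁ f g) e =
      ∑ i : Fin m, (((n : ℤ) - 1) * (i : ℤ)).negOnePow • circAt h₂ j (circAt h₁ i f g) e :=
    map_sum_intUnits_smul ((circAtHom h₂ j).flip e) _ _
  rw [circ]
  simp only [hfg, Finset.smul_sum, smul_smul, ← Int.negOnePow_add]
  rw [Finset.sum_comm, sum_sum_eq_sum_window_add_sum_pair h₁, circNested, brace, brace,
    Finset.smul_sum]
  congr 1
  · congr 1
    · refine Finset.sum_congr rfl fun i _ => Finset.sum_congr rfl fun l _ => ?_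
      congr 2
      push_cast
      ring
    · refine Finset.sum_congr rfl fun P _ => ?_
      have : (P.1.1 : ℕ) < P.1.2 := P.2
      obtain rfl : M = m + n - 1 := by omega
      congr 2
      have hj : ((P.1.2 + n - 1 : ℕ) : ℤ) = P.1.2 + n - 1 := by omega
      rw [hj]
      ring
  · refine Finset.sum_congr rfl fun P _ => ?_
    have : (P.1.1 : ℕ) < P.1.2 := P.2
    rw [circAt_circAt_of_lt (M := m + p - 1) (by omega) (by omega) h₁ h₂ P.2, smul_smul,
      ← Int.negOnePow_add]
    congr 1
    exact (Int.negOnePow_eq_iff _ _).2 ⟨-(((n : ℤ) - 1) * (p - 1)), by ring⟩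

theorem Coch.circ_circ_sub_circ_circ (h₁ : M + 1 = m + n) (h₂ : N + 1 = M + p)
    (h₃ : K + 1 = n + p) (f : Coch k A B m) (g : Coch k A B n) (e : Coch k A B p) :
    circ h₂ (circ h₁ f g) e - circ (by omega) f (circ h₃ g e) = brace (by omega) f g e +
      (((n : ℤ) - 1) * ((p : ℤ) - 1)).negOnePow • brace (by omega) f e g := by
  rw [circ_circ_left h₁ h₂, circ_circ_right h₁ h₂ h₃]
  abel

theorem Coch.circ_circ_of_degree_zero (h₁ : M + 1 = m + 0) (h₂ : N + 1 = M + 0)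
    (f : Coch k A B m) (g e : Coch k A B 0) :
    circ h₂ (circ h₁ f g) e = brace (by omega) f g e - brace (by omega) f e g := by
  rw [circ_circ_left h₁ h₂]
  simp [circNested, sub_eq_add_neg]

end Brace

section Mul

variable {k A B : Type*} [Field k] [Ring A] [Algebra k A] [CommRing B] [Algebra k B]
variable {m n M N : ℕ}

theorem Coch.eval_mulCoch (ε : B →ₐ[k] A) (a : Fin 2 → A) (b : Pair 2 → B) :
    (mulCoch ε).eval a b = ε (b ⟨(0, 1), by decide⟩) * a 0 * a 1 :=
  eval_mk _ _ a b

theorem Coch.deltaMiddle_eq_circAt (ε : B →ₐ[k] A) (f : Coch k A B n) (i : Fin n) :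
    f.deltaMiddle ε i = circAt (n := 2) rfl i f (mulCoch ε) :=
  ext_eval fun a b => by
    rw [eval_circAt, eval_mulCoch, deltaMiddle, eval_mk]
    rfl

variable (ε : B →ₐ[k] A) (hε : ∀ b, ε b ∈ Subalgebra.center k A)
include hε

theorem Coch.deltaFirst_eq_circAt (h : n + 1 + 1 = 2 + n) (f : Coch k A B n) :
    f.deltaFirst ε = circAt h 1 (mulCoch ε) f := by
  refine ext_eval fun a b => ?_
  have hcollapse : ∀ t, collapse h 1 t = 0 ↔ (t : ℕ) < 1 := fun t => by
    simp only [collapse, Fin.ext_iff, Fin.val_zero, Fin.val_one]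
    split_ifs <;> grind
  rw [eval_circAt, eval_mulCoch, deltaFirst, eval_mk, mergeB_eq_pushB,
    crossProd_eq_pushB hcollapse, Subalgebra.mem_center_iff.1 (hε _)]
  rfl

theorem Coch.deltaLast_eq_circAt (h : n + 1 + 1 = 2 + n) (f : Coch k A B n) :
    f.deltaLast ε = circAt h 0 (mulCoch ε) f := by
  refine ext_eval fun a b => ?_
  have hcollapse : ∀ t, collapse h 0 t = 0 ↔ (t : ℕ) < n := fun t => by
    simp only [collapse, Fin.ext_iff, Fin.val_zero]
    split_ifs <;> omega
  rw [eval_circAt, eval_mulCoch, deltaLast, eval_mk, mergeB_eq_pushB,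
    crossProd_eq_pushB hcollapse, mul_assoc (ε _), Subalgebra.mem_center_iff.1 (hε _)]
  simp [mergeA, Fin.last]

theorem Coch.cup_eq_circAt (h : m + n = N) (h₁ : M + 1 = 2 + m) (h₂ : N + 1 = M + n)
    (f : Coch k A B m) (g : Coch k A B n) :
    cup ε h f g = circAt h₂ ⟨m, by omega⟩ (circAt h₁ 0 (mulCoch ε) f) g := by
  refine ext_eval fun a b => ?_
  have hcollapse : ∀ t, (collapse h₁ 0 ∘ collapse h₂ ⟨m, by omega⟩) t = 0 ↔ (t : ℕ) < m :=
    fun t => by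
      simp only [collapse, Fin.ext_iff, Fin.val_zero, Function.comp_apply]
      split_ifs <;> omega
  rw [eval_circAt, eval_circAt, eval_mulCoch, cup, eval_mk, mergeB_eq_pushB h₁,
    mergeB_eq_pushB h₂, pushB_pushB (collapse_monotone _ _), crossProd_eq_pushB hcollapse,
    Subalgebra.mem_center_iff.1 (hε _), ← mergeB_eq_pushB h₂]
  have hwindow : 0 + m ≤ m := (zero_add m).le
  simp only [Fin.val_zero, mergeA_comp_window_of_le h₂ (j := ⟨m, by omega⟩) hwindow,
    mergeB_comp_windowPair_of_le h₂ (j := ⟨m, by omega⟩) hwindow]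
  simp [mergeA]

theorem Coch.delta_eq_circ (h : n + 1 + 1 = 2 + n) (f : Coch k A B n) :
    delta ε f =
      ((n : ℤ) - 1).negOnePow • circ h (mulCoch ε) f - circ (n := 2) rfl f (mulCoch ε) := by
  have hmul : ((n : ℤ) - 1).negOnePow • circ h (mulCoch ε) f =
      f.deltaFirst ε + ((n : ℤ) + 1).negOnePow • f.deltaLast ε := by
    have hsign : ((n : ℤ) - 1).negOnePow = ((n : ℤ) + 1).negOnePow :=
      (Int.negOnePow_eq_iff _ _).2 ⟨-1, by ring⟩
    simp only [circ, Fin.sum_univ_two, smul_add, smul_smul, Fin.val_zero, Fin.val_one,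
      Nat.cast_zero, Nat.cast_one, mul_zero, mul_one, Int.negOnePow_zero, Int.units_mul_self,
      one_smul, hsign, deltaFirst_eq_circAt ε hε h, deltaLast_eq_circAt ε hε h]
    exact add_comm (G := Coch k A B (n + 1)) _ _
  have hmiddle : circ (n := 2) rfl f (mulCoch ε) =
      -∑ i : Fin n, ((i : ℤ) + 1).negOnePow • f.deltaMiddle ε i := by
    simp [circ, deltaMiddle_eq_circAt, Int.negOnePow_succ]
  rw [hmul, hmiddle, delta]
  abel

theorem Coch.brace_mulCoch (h : N + 2 = 2 + m + n) (h' : m + n = N) (f : Coch k A B m)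
    (g : Coch k A B n) :
    brace h (mulCoch ε) f g = (((n : ℤ) - 1) * m).negOnePow • cup ε h' f g := by
  have univ_pair : (Finset.univ : Finset (Pair 2)) = {⟨(0, 1), by decide⟩} := by decide
  rw [brace, univ_pair, Finset.sum_singleton,
    cup_eq_circAt ε hε h' (M := 2 + m - 1) (by omega) (by omega)]
  simp

end Mul

section GradedOperations

variable {k A B : Type*} [Field k] [Ring A] [Algebra k A] [CommRing B] [Algebra k B]
variable {m n p q M K : ℤ}

theorem circ_add_left (h : p + 1 = m + n) (f f' : Cochain k A B m) (g : Cochain k A B n) :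
    circ h (f + f') g = circ h f g + circ h f' g := by
  rcases m with m | m <;> rcases n with n | n <;> rcases p with p | p <;>
    first
    | exact Coch.circ_add_left _ f f' g
    | exact (add_zero _).symm

theorem circ_add_right (h : p + 1 = m + n) (f : Cochain k A B m) (g g' : Cochain k A B n) :
    circ h f (g + g') = circ h f g + circ h f g' := by
  rcases m with m | m <;> rcases n with n | n <;> rcases p with p | p <;>
    first
    | exact Coch.circ_add_right _ f g g'
    | exact (add_zero _).symm

/-- The composition `∘` as a biadditive map. -/
noncomputable def circHom (h : p + 1 = m + n) :
    Cochain k A B m →+ Cochain k A B n →+ Cochain k A B p :=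
  .mk' (fun f => .mk' (circ h f) (circ_add_right h f))
    fun f f' => AddMonoidHom.ext (circ_add_left h f f')

theorem circ_zero_left (h : p + 1 = m + n) (g : Cochain k A B n) :
    circ h (0 : Cochain k A B m) g = 0 :=
  map_zero ((circHom h).flip g)

theorem circ_zero_right (h : p + 1 = m + n) (f : Cochain k A B m) :
    circ h f (0 : Cochain k A B n) = 0 :=
  map_zero (circHom h f)

theorem circ_smul_sub_left (h : p + 1 = m + n) (u : ℤˣ) (f f' : Cochain k A B m)
    (g : Cochain k A B n) : circ h (u • f - f') g = u • circ h f g - circ h f' g :=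
  (map_sub ((circHom h).flip g) _ _).trans
    (congrArg (· - _) (map_intUnits_smul ((circHom h).flip g) u f))

theorem circ_smul_sub_right (h : p + 1 = m + n) (f : Cochain k A B m) (u : ℤˣ)
    (g g' : Cochain k A B n) : circ h f (u • g - g') = u • circ h f g - circ h f g' :=
  (map_sub (circHom h f) _ _).trans (congrArg (· - _) (map_intUnits_smul (circHom h f) u g))

theorem Cochain.eq_zero_of_neg (hn : n < 0) (f : Cochain k A B n) : f = 0 := by
  rcases n with n | n
  · exact absurd hn (Int.not_ofNat_neg n)
  · rfl

/-- The cochain `a₁ ⊗ a₂ ⊗ b ↦ ε(b) a₁ a₂` in the graded setting. -/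
noncomputable def mulCochain (ε : B →ₐ[k] A) : Cochain k A B 2 := Coch.mulCoch ε

/-- The brace operation `f{g, e}` in all integer degrees; it vanishes if a degree is negative. -/
noncomputable def brace : {m n p q : ℤ} → q + 2 = m + n + p → Cochain k A B m → Cochain k A B n →
    Cochain k A B p → Cochain k A B q
  | Int.ofNat _, Int.ofNat _, Int.ofNat _, Int.ofNat _, h, f, g, e =>
    Coch.brace (by simp only [Int.ofNat_eq_natCast] at h; omega) f g e
  | _, _, _, _, _, _, _, _ => 0

/-- The associator `(f ∘ g) ∘ e - f ∘ (g ∘ e)`. The degrees `M` and `K` of `f ∘ g` and `g ∘ e`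
are given up to equalities of integers, as in `circ`. -/
noncomputable def assoc (hM : M + 1 = m + n) (hK : K + 1 = n + p) (h : q + 2 = m + n + p)
    (f : Cochain k A B m) (g : Cochain k A B n) (e : Cochain k A B p) : Cochain k A B q :=
  circ (by linarith) (circ hM f g) e - circ (by linarith) f (circ hK g e)

theorem circ_eq_zero (h : p + 1 = m + n) (hdeg : m ≤ 0 ∨ n < 0 ∨ p < 0)
    (f : Cochain k A B m) (g : Cochain k A B n) : circ h f g = 0 := by
  rcases m with (_ | m) | m <;> rcases n with n | n <;> rcases p with p | p <;>
    first
    | rfl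
    | grind

theorem brace_eq_zero (h : q + 2 = m + n + p) (hdeg : m ≤ 0 ∨ n < 0 ∨ p < 0 ∨ q < 0)
    (f : Cochain k A B m) (g : Cochain k A B n) (e : Cochain k A B p) : brace h f g e = 0 := by
  rcases m with (_ | m) | m <;> rcases n with n | n <;> rcases p with p | p <;>
    rcases q with q | q <;>
    first
    | rfl
    | grind

theorem assoc_eq_zero (hM : M + 1 = m + n) (hK : K + 1 = n + p) (h : q + 2 = m + n + p)
    (hdeg : m ≤ 0 ∨ n < 0 ∨ p < 0 ∨ q < 0)
    (f : Cochain k A B m) (g : Cochain k A B n) (e : Cochain k A B p) :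
    assoc hM hK h f g e = 0 := by
  have hleft : circ (p := q) (by linarith) (circ hM f g) e = 0 := by
    rcases hdeg with hm | hn | hp
    · rw [circ_eq_zero hM (.inl hm), circ_zero_left]
    · rw [circ_eq_zero hM (.inr (.inl hn)), circ_zero_left]
    · exact circ_eq_zero _ (.inr hp) _ _
  have hright : circ (p := q) (by linarith) f (circ hK g e) = 0 := by
    rcases hdeg with hm | hn | hp | hq
    · exact circ_eq_zero _ (.inl hm) _ _
    · rw [circ_eq_zero hK (.inl hn.le), circ_zero_right]
    · rw [circ_eq_zero hK (.inr (.inl hp)), circ_zero_right]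
    · exact circ_eq_zero _ (.inr (.inr hq)) _ _
  rw [assoc, hleft, hright, sub_zero]

theorem assoc_eq_brace (hM : M + 1 = m + n) (hK : K + 1 = n + p) (h : q + 2 = m + n + p)
    (h' : q + 2 = m + p + n)
    (f : Cochain k A B m) (g : Cochain k A B n) (e : Cochain k A B p) :
    assoc hM hK h f g e = brace h f g e + ((n - 1) * (p - 1)).negOnePow • brace h' f e g := by
  by_cases hdeg : m ≤ 0 ∨ n < 0 ∨ p < 0 ∨ q < 0
  · rw [assoc_eq_zero hM hK h hdeg, brace_eq_zero h hdeg, brace_eq_zero h' (by tauto), smul_zero,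
      add_zero]
  · have hm : 0 ≤ m := by omega
    have hn : 0 ≤ n := by omega
    have hp : 0 ≤ p := by omega
    have hq : 0 ≤ q := by omega
    have hM' : 0 ≤ M := by omega
    lift m to ℕ using hm
    lift n to ℕ using hn
    lift p to ℕ using hp
    lift q to ℕ using hq
    lift M to ℕ using hM'
    rcases K with K | K
    · exact Coch.circ_circ_sub_circ_circ (by grind) (by grind) (by grind) f g e
    · obtain rfl : n = 0 := by grind
      obtain rfl : p = 0 := by grind
      have hsign : ((((0 : ℕ) : ℤ) - 1) * (((0 : ℕ) : ℤ) - 1)).negOnePow = -1 := rfl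
      rw [assoc, Cochain.eq_zero_of_neg (Int.negSucc_lt_zero K) (circ hK g e), circ_zero_right,
        sub_zero, hsign, Units.neg_smul, one_smul, ← sub_eq_add_neg]
      exact Coch.circ_circ_of_degree_zero (by grind) (by grind) f g e

theorem delta_eq_circ (ε : B →ₐ[k] A) (hε : ∀ b, ε b ∈ Subalgebra.center k A) (h : n + 1 = p)
    (f : Cochain k A B n) :
    delta ε h f = (n - 1).negOnePow • circ (by linarith) (mulCochain ε) f -
      circ (by linarith) f (mulCochain ε) := by
  subst h
  rcases n with n | n
  · exact Coch.delta_eq_circ ε hε _ f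
  · rw [Cochain.eq_zero_of_neg (Int.negSucc_lt_zero n) f, circ_zero_left, circ_zero_right,
      smul_zero, sub_zero]
    rfl

theorem brace_mulCochain (ε : B →ₐ[k] A) (hε : ∀ b, ε b ∈ Subalgebra.center k A)
    (h : q + 2 = 2 + m + n) (h' : m + n = q) (f : Cochain k A B m) (g : Cochain k A B n) :
    brace h (mulCochain ε) f g = ((n - 1) * m).negOnePow • cup ε h' f g := by
  rcases m with m | m <;> rcases n with n | n <;> rcases q with q | q
  · exact Coch.brace_mulCoch ε hε (Int.ofNat.inj h) (Int.ofNat.inj h') f g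
  all_goals exact (smul_zero (M := ℤˣ) (A := Cochain k A B _) _).symm

theorem assoc_comm {K' M' : ℤ} (hM : M + 1 = m + n) (hK : K + 1 = n + p) (hM' : M' + 1 = m + p)
    (hK' : K' + 1 = p + n) (h : q + 2 = m + n + p) (h' : q + 2 = m + p + n)
    (f : Cochain k A B m) (g : Cochain k A B n) (e : Cochain k A B p) :
    assoc hM hK h f g e = ((n - 1) * (p - 1)).negOnePow • assoc hM' hK' h' f e g := by
  rw [assoc_eq_brace hM hK h h', assoc_eq_brace hM' hK' h' h, smul_add, smul_smul,
    mul_comm (p - 1), Int.units_mul_self, one_smul, add_comm]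

theorem assoc_mulCochain (ε : B →ₐ[k] A) (hε : ∀ b, ε b ∈ Subalgebra.center k A)
    (hM : M + 1 = 2 + m) (hK : K + 1 = m + n) (h : q + 2 = 2 + m + n) (h₁ : m + n = q)
    (h₂ : n + m = q) (f : Cochain k A B m) (g : Cochain k A B n) :
    assoc hM hK h (mulCochain ε) f g =
      (m - 1).negOnePow • (cup ε h₂ g f - (m * n).negOnePow • cup ε h₁ f g) := by
  have hsign_brace_fg : (m - 1 + m * n).negOnePow = -((n - 1) * m).negOnePow := by
    rw [← Int.negOnePow_succ, Int.negOnePow_eq_iff]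
    exact ⟨m - 1, by ring⟩
  have hsign_brace_gf : ((m - 1) * (n - 1) + (m - 1) * n).negOnePow = (m - 1).negOnePow := by
    rw [Int.negOnePow_eq_iff]
    exact ⟨(m - 1) * (n - 1), by ring⟩
  rw [assoc_eq_brace hM hK h (by linarith), brace_mulCochain ε hε h h₁,
    brace_mulCochain ε hε _ h₂, smul_smul, ← Int.negOnePow_add, hsign_brace_gf, smul_sub, smul_smul,
    ← Int.negOnePow_add, hsign_brace_fg, Units.neg_smul]
  abel

theorem circ_delta_sub_delta_circ_add_delta_circ (ε : B →ₐ[k] A)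
    (hε : ∀ b, ε b ∈ Subalgebra.center k A) {m' n' : ℤ} (hM : M + 1 = m + n)
    (hm : m + 1 = m') (hn : n + 1 = n') (hq : m + n = q) (f : Cochain k A B m)
    (g : Cochain k A B n) :
    circ (p := q) (by linarith) f (delta ε hn g) - delta ε (by linarith) (circ hM f g) +
        (n - 1).negOnePow • circ (p := q) (by linarith) (delta ε hm f) g =
      ((n - 1) + (m - 1)).negOnePow •
        assoc (M := m') (by linarith) hM (by linarith) (mulCochain ε) f g := by
  have hcomm : assoc hM (K := n') (by linarith) (by linarith) f g (mulCochain ε) =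
      (n - 1).negOnePow • assoc (q := q) (M := m') (K := n') (by linarith) (by linarith)
        (by linarith) f (mulCochain ε) g := by
    rw [assoc_comm (M' := m') (K' := n') hM _ (by linarith) (by linarith) _ (by linarith),
      show (2 : ℤ) - 1 = 1 from rfl, mul_one]
  have hsign : (M - 1).negOnePow = (n - 1).negOnePow * (m - 1).negOnePow := by
    rw [← Int.negOnePow_add, ← sub_eq_iff_eq_add.2 hM]
    congr 1
    ring
  simp only [assoc, smul_sub, sub_eq_iff_eq_add] at hcomm
  simp only [assoc, delta_eq_circ ε hε, circ_smul_sub_left, circ_smul_sub_right, hsign,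
    Int.negOnePow_add, smul_sub, smul_smul, hcomm]
  abel

end GradedOperations

end SecondaryHochschild

theorem mainTheorem3 {k A B : Type*} [Field k] [Ring A] [Algebra k A] [CommRing B] [Algebra k B]
    (ε : B →ₐ[k] A) (hε : ∀ b : B, ε b ∈ Subalgebra.center k A)
    (m n : ℤ) (f : SecondaryHochschild.Cochain k A B m) (g : SecondaryHochschild.Cochain k A B n) :
    (SecondaryHochschild.circ (by ring) f (SecondaryHochschild.delta ε rfl g) -
        SecondaryHochschild.delta ε (by ring)
          (SecondaryHochschild.circ (p := m + n - 1) (by ring) f g) +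
        (n - 1).negOnePow •
          SecondaryHochschild.circ (by ring) (SecondaryHochschild.delta ε rfl f) g :
      SecondaryHochschild.Cochain k A B (m + n)) =
    (n - 1).negOnePow •
      (SecondaryHochschild.cup ε (by ring) g f -
        (m * n).negOnePow • SecondaryHochschild.cup ε rfl f g) := by
  rw [SecondaryHochschild.circ_delta_sub_delta_circ_add_delta_circ ε hε _ rfl rfl rfl f g,
    SecondaryHochschild.assoc_mulCochain ε hε _ _ _ rfl (add_comm n m) f g, smul_smul,
    Int.negOnePow_add, mul_assoc, Int.units_mul_self, mul_one]
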